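/- Let $f:\mathbb R\to\mathbb R$ be $C^2$ with $f''>0$ on $\mathbb R$, and let $u_+<u_-$. Put $$\lambda=\frac{f(u_+)-f(u_-)}{u_+-u_-},\qquad g(v)=f(v)-f(u_-)-\lambda(v-u_-),\qquad S=\max_{v\in[u_+,u_-]}[-g(v)],$$ and, for $\alpha>1/2$, $$\epsilon_{min}(\alpha)=2^\alpha S\left(\frac{\alpha}{2\alpha-1}\right)^\alpha\sqrt{2\alpha-1}.$$ For $\alpha\ge 0$, $\epsilon>0$, $\delta>0$ consider the system $$v'=w,\qquad w'=\frac1\delta\left[-\frac{\epsilon w}{(1+w^2)^\alpha}+g(v)\right].\qquad(*)$$ A monotone travelling wave of $(*)$ is a solution $(v,w)$ on $\mathbb R$ with $v$ strictly decreasing, $(v,w)\to(u_-,0)$ at $-\infty$ and $(v,w)\to(u_+,0)$ at $+\infty$. When $\epsilon^2/\delta^2+4g'(u_+)/\delta>0$, the linearisation of $(*)$ at $(u_+,0)$ has the two distinct real eigenvalues $$\chi_\pm=\frac12\left(-\frac\epsilon\delta\pm\sqrt{\frac{\epsilon^2}{\delta^2}+\frac{4g'(u_+)}{\delta}}\right),$$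 and the main direction is that of the eigenvector $(1,\chi_+)$ of $\chi_+$; a monotone travelling wave enters $(u_+,0)$ through the main direction if $w/(v-u_+)\to\chi_+$ at $+\infty$. Then $\lim_{\alpha\to(1/2)_+}\epsilon_{min}(\alpha)=S$. Moreover, let $\alpha\ge0$ and fix $\epsilon$ such that either $$\epsilon>\begin{cases}\epsilon_{min}(\alpha)&\text{if }\alpha>1/2,\\ S&\text{if }\alpha=1/2,\\ 0&\text{if }\alpha<1/2,\end{cases}$$ or $\alpha>1/2$ and $\epsilon=\epsilon_{min}(\alpha)$. Then there exists $\delta_0=\delta_0(\alpha,\epsilon)>0$ such that for all $0<\delta<\delta_0$: (i) $(*)$ admits a monotone travelling wave; (ii) $\epsilon^2/\delta^2+4g'(u_+)/\delta>0$, and every monotone travelling wave of $(*)$ enters $(u_+,0)$ through the main direction. -/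

import Mathlib

open Filter Topology Set

noncomputable section

namespace RosenauKdV

/-- The Rankine–Hugoniot speed `λ = (f(u₊) - f(u₋)) / (u₊ - u₋)`. -/
def speed (f : ℝ → ℝ) (up um : ℝ) : ℝ := (f up - f um) / (up - um)

/-- `g(v) = f(v) - f(u₋) - λ (v - u₋)`. -/
def g (f : ℝ → ℝ) (up um v : ℝ) : ℝ := f v - f um - speed f up um * (v - um)

/-- `S = max_{v ∈ [u₊, u₋]} (-g(v))`; for continuous `f` and `u₊ ≤ u₋` the supremum is attained. -/
def S (f : ℝ → ℝ) (up um : ℝ) : ℝ := sSup ((fun v => -g f up um v) '' Icc up um)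

/-- `ε_min(α) = 2^α S (α / (2α - 1))^α √(2α - 1)`, used for `α > 1/2`. -/
def epsMin (f : ℝ → ℝ) (up um α : ℝ) : ℝ :=
  2 ^ α * S f up um * (α / (2 * α - 1)) ^ α * Real.sqrt (2 * α - 1)

/-- The threshold: `ε_min(α)` if `α > 1/2`, `S` if `α = 1/2`, `0` if `α < 1/2`. -/
def threshold (f : ℝ → ℝ) (up um α : ℝ) : ℝ :=
  if 1 / 2 < α then epsMin f up um α else if α = 1 / 2 then S f up um else 0

/-- `(v, w)` is a global solution of
`v' = w`, `w' = (1/δ) (-ε w / (1 + w²)^α + g(v))` which is a heteroclinic orbit from `(u₋, 0)`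
(at `-∞`) to `(u₊, 0)` (at `+∞`) along which `v` is decreasing. -/
structure IsMonotoneTravellingWave (f : ℝ → ℝ) (up um α ε δ : ℝ) (v w : ℝ → ℝ) : Prop where
  v_eq : ∀ ζ : ℝ, HasDerivAt v (w ζ) ζ
  w_eq : ∀ ζ : ℝ,
    HasDerivAt w ((1 / δ) * (-(ε * w ζ / (1 + w ζ ^ 2) ^ α) + g f up um (v ζ))) ζ
  v_atBot : Tendsto v atBot (𝓝 um)
  w_atBot : Tendsto w atBot (𝓝 0)
  v_atTop : Tendsto v atTop (𝓝 up)
  w_atTop : Tendsto w atTop (𝓝 0)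
  decreasing : StrictAnti v

/-- The discriminant `ε²/δ² + 4 g'(u₊)/δ` of the linearisation at `(u₊, 0)`, whose matrix is
`!![0, 1; g'(u₊)/δ, -ε/δ]`. -/
def disc (f : ℝ → ℝ) (up um ε δ : ℝ) : ℝ :=
  ε ^ 2 / δ ^ 2 + 4 * deriv (g f up um) up / δ

/-- The larger (slow) eigenvalue `χ₊` of the linearisation at `(u₊, 0)`, when `disc` is positive.
A corresponding eigenvector is `(1, χ₊)`. -/
def chiPlus (f : ℝ → ℝ) (up um ε δ : ℝ) : ℝ :=
  (1 / 2) * (-(ε / δ) + Real.sqrt (disc f up um ε δ))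

/-- The orbit `(v, w)` enters `(u₊, 0)` through the main direction: the two eigenvalues at
`(u₊, 0)` are real and distinct, and the slope of the secant from `(u₊, 0)` to the point
`(v(ζ), w(ζ))` tends to the slope `χ₊` of the eigenvector `(1, χ₊)`. Used for orbits
with `v(ζ) ≠ u₊` for all `ζ`. -/
def EntersThroughMainDirection (f : ℝ → ℝ) (up um ε δ : ℝ) (v w : ℝ → ℝ) : Prop :=
  0 < disc f up um ε δ ∧
    Tendsto (fun ζ => w ζ / (v ζ - up)) atTop (𝓝 (chiPlus f up um ε δ))

end RosenauKdV

end

/-! Along a monotone wave `w < 0`, so `s = u₋ - v` can replace time, and `y = w²` solves the scalar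
equation `y' = (2/δ)(-g(u₋ - s) - ε φ(√y))` with friction `φ(z) = z/(1+z²)^α`. Two barriers control
it.

The first is a level `z₀`. The condition on `ε` yields `z₀` with `S ≤ ε φ(z₀)` and `φ` increasing on
`[0, z₀]` (`exists_balancing_slope`): friction at `z₀` balances the largest driving force, so `|w| ≤
z₀`.

The second is a ray `w = -k(v - u₊)`. Below `z₀`, friction dominates a linear law of slope
`(1+z₀²)^(-α)`, and convexity gives `-g(v) ≤ m(v - u₊)` with `m = -g'(u₊)`. The ray cannot be
crossed once `m/k + kδ < c = ε(1+z₀²)^(-α)` (`ray_barrier`), which some `k` satisfies for small `δ`.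

For existence, the profile `y` starts at `0`, and the ray forces `√y` to vanish linearly at `u₊`
(`exists_profile`); integrating `s' = √y(s)` restores time (`exists_flow_connecting`). For the main
direction, the same ray keeps `Q = w/(v - u₊)` above `-k > χ₋`, and the perturbed Riccati equation
for `Q` then drives it to `χ₊`. -/

namespace RosenauKdV

/-! ### Scalar comparison, Cauchy problems with monotone nonlinearity, connecting flows -/

/-- A function which does not increase wherever it is positive, and is nonpositive at the left
endpoint, stays nonpositive. -/
lemma nonpos_of_deriv_nonpos_of_pos {a b : ℝ} {y y' : ℝ → ℝ} (hab : a ≤ b)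
    (hc : ContinuousOn y (Icc a b)) (hd : ∀ s ∈ Ioo a b, HasDerivAt y (y' s) s)
    (h : ∀ s ∈ Ioo a b, 0 < y s → y' s ≤ 0) (ha : y a ≤ 0) : y b ≤ 0 := by
  by_contra! hb
  -- Past the last point of `A`, `y` is positive and hence antitone, so it cannot climb to `y b >
  -- 0`.
  let A : Set ℝ := {t | t ∈ Icc a b ∧ y t ≤ 0}
  have hAcl : IsClosed A := by
    have := hc.preimage_isClosed_of_isClosed isClosed_Icc (isClosed_Iic (a := (0 : ℝ)))
    exact this
  have hAne : A.Nonempty := ⟨a, ⟨le_refl a, hab⟩, ha⟩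
  have hAb : BddAbove A := ⟨b, fun t ht => ht.1.2⟩
  have hmem : sSup A ∈ A := hAcl.csSup_mem hAne hAb
  set t := sSup A with ht
  have htb : t < b := lt_of_le_of_ne hmem.1.2 (fun h0 => by
    have := hmem.2
    rw [h0] at this
    linarith)
  have hpos : ∀ s ∈ Ioc t b, 0 < y s := by
    intro s hs
    by_contra! h0
    have : s ≤ t := le_csSup hAb ⟨⟨hmem.1.1.trans hs.1.le, hs.2⟩, h0⟩
    linarith [hs.1]
  have hsub : ∀ s ∈ Ioo t b, s ∈ Ioo a b := fun s hs => ⟨lt_of_le_of_lt hmem.1.1 hs.1, hs.2⟩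
  have hanti : AntitoneOn y (Icc t b) := by
    apply antitoneOn_of_deriv_nonpos (convex_Icc t b) (hc.mono (Icc_subset_Icc_left hmem.1.1))
    · intro s hs
      rw [interior_Icc] at hs
      exact (hd s (hsub s hs)).differentiableAt.differentiableWithinAt
    · intro s hs
      rw [interior_Icc] at hs
      rw [(hd s (hsub s hs)).deriv]
      exact h s (hsub s hs) (hpos s ⟨hs.1, hs.2.le⟩)
  have := hanti ⟨le_refl t, htb.le⟩ ⟨htb.le, le_refl b⟩ htb.le
  linarith [hmem.2]

/-- A differentiable function on a half-line which decreases at a uniform rate wherever it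
exceeds the level `c` is eventually at most `c`. -/
lemma eventually_le_of_deriv_le {y y' : ℝ → ℝ} {T c κ : ℝ} (hκ : 0 < κ)
    (hd : ∀ t, HasDerivAt y (y' t) t) (h : ∀ t ≥ T, c < y t → y' t ≤ -κ) :
    ∀ᶠ t in atTop, y t ≤ c := by
  have hex : ∃ t₁ ≥ T, y t₁ ≤ c := by
    by_contra! hcon
    -- The time at which a decrease at rate `κ` from `y T` reaches `c`.
    let t₁ := T + (y T - c) / κ
    have hT : 0 < y T - c := by linarith [hcon T le_rfl]
    have ht₁ : T ≤ t₁ := by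
      have := div_pos hT hκ
      simp only [t₁]; linarith
    have key := nonpos_of_deriv_nonpos_of_pos (a := T) (b := t₁)
      (y := fun t => y t - y T + κ * (t - T)) (y' := fun t => y' t + κ) ht₁
      (fun t _ => by
        have := (hd t).continuousAt.continuousWithinAt (s := Icc T t₁)
        fun_prop)
      (fun t _ => by
        simpa using ((hd t).sub_const (y T)).fun_add (((hasDerivAt_id t).sub_const T).const_mul κ))
      (fun t ht _ => by linarith [h t ht.1.le (hcon t ht.1.le)]) (by simp)
    have h1 : κ * (t₁ - T) = y T - c := by
      simp only [t₁]; field_simp; ring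
    simp only [h1] at key
    linarith [hcon t₁ ht₁]
  obtain ⟨t₁, ht₁, hy⟩ := hex
  filter_upwards [eventually_ge_atTop t₁] with t ht
  have key := nonpos_of_deriv_nonpos_of_pos (a := t₁) (b := t)
    (y := fun t => y t - c) (y' := y') ht
    (fun t _ => ((hd t).continuousAt.sub continuousAt_const).continuousWithinAt)
    (fun t _ => (hd t).sub_const c)
    (fun s hs h0 => by linarith [h s (ht₁.le.trans hs.1.le) (by linarith)]) (by linarith)
  linarith

/-- Global solution on `[0, L]` of a bounded scalar Lipschitz equation `y' = G(s) - h(y)`. -/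
lemma exists_solution_of_lipschitz {L : ℝ} (hL : 0 ≤ L) {G h : ℝ → ℝ} (hG : Continuous G)
    {K : NNReal} (hh : LipschitzWith K h) {B : ℝ} (hB : ∀ x, |h x| ≤ B) :
    ∃ y : ℝ → ℝ, y 0 = 0 ∧ ContinuousOn y (Icc 0 L) ∧
      ∀ s ∈ Ioo 0 L, HasDerivAt y (G s - h (y s)) s := by
  obtain ⟨C, hC⟩ := (isCompact_Icc (a := (0:ℝ)) (b := L)).exists_bound_of_continuousOn
    hG.continuousOn
  have hC0 : 0 ≤ C := (norm_nonneg _).trans (hC 0 ⟨le_refl _, hL⟩)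
  have hB0 : 0 ≤ B := (abs_nonneg _).trans (hB 0)
  let D : NNReal := ⟨C + B, by positivity⟩
  let L' : NNReal := ⟨L, hL⟩
  -- The field is bounded by `C + B` everywhere, so a ball of radius `D * L` is never left and the
  -- solution covers all of `[0, L]`.
  have hP : IsPicardLindelof (fun s x => G s - h x) (tmin := 0) (tmax := L)
      ⟨0, ⟨le_refl _, hL⟩⟩ (0:ℝ) (D * L') 0 D K := by
    refine ⟨?_, ?_, ?_, ?_⟩
    · intro t _
      apply LipschitzWith.lipschitzOnWith
      refine LipschitzWith.of_dist_le_mul fun x y => ?_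
      have := hh.dist_le_mul y x
      rw [dist_comm y x] at this
      rw [Real.dist_eq] at this ⊢
      rwa [sub_sub_sub_cancel_left]
    · intro x _
      fun_prop
    · intro t ht x _
      have h1 := hC t ht
      have h2 := hB x
      calc ‖G t - h x‖ ≤ ‖G t‖ + ‖h x‖ := norm_sub_le _ _
        _ ≤ C + B := add_le_add h1 h2
    · have h1 : ((D * L' : NNReal) : ℝ) = D * L := rfl
      simp [h1, hL]
  obtain ⟨y, h0, hy⟩ := hP.exists_eq_forall_mem_Icc_hasDerivWithinAt₀
  exact ⟨y, h0, fun s hs => (hy s hs).continuousWithinAt,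
    fun s hs => (hy s ⟨hs.1.le, hs.2.le⟩).hasDerivAt (Icc_mem_nhds hs.1 hs.2)⟩

/-- Continuous dependence for scalar equations `y' = G(s) - h(y)` with monotone `h`. -/
lemma sub_le_of_monotone {L : ℝ} {G h₁ h₂ y₁ y₂ : ℝ → ℝ} {η : ℝ} (hη : 0 ≤ η)
    (h₂m : Monotone h₂) (hη' : ∀ x, |h₁ x - h₂ x| ≤ η)
    (c₁ : ContinuousOn y₁ (Icc 0 L)) (c₂ : ContinuousOn y₂ (Icc 0 L))
    (d₁ : ∀ s ∈ Ioo 0 L, HasDerivAt y₁ (G s - h₁ (y₁ s)) s)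
    (d₂ : ∀ s ∈ Ioo 0 L, HasDerivAt y₂ (G s - h₂ (y₂ s)) s) (h0 : y₁ 0 = y₂ 0) :
    ∀ s ∈ Icc 0 L, y₁ s - y₂ s ≤ η * L := by
  intro s hs
  have hsub : ∀ t ∈ Ioo 0 s, t ∈ Ioo 0 L := fun t ht => ⟨ht.1, ht.2.trans_le hs.2⟩
  have hI : Icc 0 s ⊆ Icc 0 L := Icc_subset_Icc_right hs.2
  -- Where `y₁ ≥ y₂`, monotonicity of `h₂` has the good sign and the gap grows at rate at most `η`.
  -- No Lipschitz constant enters, so the bound survives when the constants `K n` blow up.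
  have key := nonpos_of_deriv_nonpos_of_pos (a := 0) (b := s)
    (y := fun t => y₁ t - y₂ t - η * t)
    (y' := fun t => (G t - h₁ (y₁ t)) - (G t - h₂ (y₂ t)) - η) hs.1
    (((c₁.mono hI).sub (c₂.mono hI)).sub (by fun_prop))
    (fun t ht => by
      simpa using ((d₁ t (hsub t ht)).fun_sub (d₂ t (hsub t ht))).fun_sub
        ((hasDerivAt_id t).const_mul η))
    (fun t ht hpos => by
      have h1 : y₂ t ≤ y₁ t := by
        have : 0 ≤ η * t := mul_nonneg hη ht.1.le
        linarith
      have h2 := h₂m h1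
      have h3 := (abs_le.1 (hη' (y₁ t))).1
      linarith) (by simp [h0])
  have : η * s ≤ η * L := mul_le_mul_of_nonneg_left hs.2 hη
  linarith

/-- Existence for `y' = G(s) - h(y)`, `y(0) = 0`, when `h` is a uniform limit of monotone
Lipschitz functions. -/
lemma exists_solution_of_monotone {L : ℝ} (hL : 0 ≤ L) {G h : ℝ → ℝ} (hG : Continuous G)
    (hh : UniformContinuous h) {B : ℝ} (hB : ∀ x, |h x| ≤ B) {H : ℕ → ℝ → ℝ} {K : ℕ → NNReal}
    (hK : ∀ n, LipschitzWith (K n) (H n)) (hmono : ∀ n, Monotone (H n)) {a : ℕ → ℝ}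
    (ha : ∀ n x, |H n x - h x| ≤ a n) (ha0 : Tendsto a atTop (𝓝 0)) :
    ∃ y : ℝ → ℝ, y 0 = 0 ∧ ContinuousOn y (Icc 0 L) ∧
      ∀ s ∈ Ioo 0 L, HasDerivAt y (G s - h (y s)) s := by
  have ann : ∀ n, 0 ≤ a n := fun n => (abs_nonneg _).trans (ha n 0)
  have hex : ∀ n, ∃ y : ℝ → ℝ, y 0 = 0 ∧ ContinuousOn y (Icc 0 L) ∧
      ∀ s ∈ Ioo 0 L, HasDerivAt y (G s - H n (y s)) s := fun n =>
    exists_solution_of_lipschitz hL hG (hK n) (B := a n + B) (fun x => by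
      calc |H n x| = |(H n x - h x) + h x| := by ring_nf
        _ ≤ |H n x - h x| + |h x| := abs_add_le _ _
        _ ≤ a n + B := add_le_add (ha n x) (hB x))
  choose Y hY0 hYc hYd using hex
  have hdist : ∀ n m, ∀ s ∈ Icc 0 L, |Y n s - Y m s| ≤ (a n + a m) * L := by
    have aux : ∀ n m, ∀ s ∈ Icc 0 L, Y n s - Y m s ≤ (a n + a m) * L := fun n m =>
      sub_le_of_monotone (add_nonneg (ann n) (ann m)) (hmono m)
        (fun x => by
          calc |H n x - H m x| = |(H n x - h x) - (H m x - h x)| := by ring_nf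
            _ ≤ |H n x - h x| + |H m x - h x| := abs_sub _ _
            _ ≤ a n + a m := add_le_add (ha n x) (ha m x))
        (hYc n) (hYc m) (hYd n) (hYd m) (by rw [hY0, hY0])
    intro n m s hs
    rw [abs_le]
    constructor
    · have := aux m n s hs
      rw [add_comm] at this
      linarith
    · exact aux n m s hs
  have hcau : UniformCauchySeqOn Y atTop (Icc 0 L) := by
    rw [Metric.uniformCauchySeqOn_iff]
    intro σ hσ
    have : Tendsto (fun n => a n * L) atTop (𝓝 0) := by simpa using ha0.mul_const L
    obtain ⟨N, hN⟩ := eventually_atTop.1 (this.eventually (gt_mem_nhds (half_pos hσ)))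
    refine ⟨N, fun m hm n hn x hx => ?_⟩
    rw [Real.dist_eq]
    have := hdist m n x hx
    linarith [hN m hm, hN n hn]
  have hlim : ∀ s, ∃ l, s ∈ Icc 0 L → Tendsto (fun n => Y n s) atTop (𝓝 l) := by
    intro s
    by_cases hs : s ∈ Icc 0 L
    · obtain ⟨l, hl⟩ := cauchySeq_tendsto_of_complete (hcau.cauchySeq hs)
      exact ⟨l, fun _ => hl⟩
    · exact ⟨0, fun h => absurd h hs⟩
  choose y hy using hlim
  have hunif : TendstoUniformlyOn Y y atTop (Icc 0 L) := hcau.tendstoUniformlyOn_of_tendsto hy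
  refine ⟨y, ?_, hunif.continuousOn (Eventually.of_forall hYc).frequently, fun s hs => ?_⟩
  · have := hy 0 ⟨le_refl _, hL⟩
    simp only [hY0] at this
    exact tendsto_nhds_unique this tendsto_const_nhds
  · refine hasDerivAt_of_tendstoUniformlyOn (l := atTop) (f := Y)
      (f' := fun n s => G s - H n (Y n s)) (g' := fun s => G s - h (y s)) isOpen_Ioo ?_
      (Eventually.of_forall hYd) (fun x hx => hy x (Ioo_subset_Icc_self hx)) hs
    rw [Metric.tendstoUniformlyOn_iff]
    intro σ hσ
    obtain ⟨τ, hτ, hτ'⟩ := Metric.uniformContinuous_iff.1 hh (σ / 2) (half_pos hσ)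
    filter_upwards [Metric.tendstoUniformlyOn_iff.1 hunif τ hτ,
      ha0.eventually (gt_mem_nhds (half_pos hσ))] with n h1 h2 x hx
    have h3 := hτ' (h1 x (Ioo_subset_Icc_self hx))
    have h4 := ha n (Y n x)
    rw [Real.dist_eq] at h3 ⊢
    calc |G x - h (y x) - (G x - H n (Y n x))|
        = |(H n (Y n x) - h (Y n x)) - (h (y x) - h (Y n x))| := by ring_nf
      _ ≤ |H n (Y n x) - h (Y n x)| + |h (y x) - h (Y n x)| := abs_sub _ _
      _ < σ := by linarith

/-- Flow of a positive scalar field on `(0, L)` vanishing at most linearly at both ends: the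
solution is global and connects the two ends. -/
lemma exists_flow_connecting {L C k : ℝ} (hL : 0 < L) (hC : 0 < C) (hk : 0 < k) {z : ℝ → ℝ}
    (hz : ContinuousOn z (Ioo 0 L)) (hpos : ∀ s ∈ Ioo 0 L, 0 < z s)
    (hzC : ∀ s ∈ Ioo 0 L, z s ≤ C * s) (hzk : ∀ s ∈ Ioo 0 L, z s ≤ k * (L - s)) :
    ∃ X : ℝ → ℝ, (∀ t, X t ∈ Ioo 0 L) ∧ (∀ t, HasDerivAt X (z (X t)) t) ∧ StrictMono X ∧
      Tendsto X atBot (𝓝 0) ∧ Tendsto X atTop (𝓝 L) := by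
  have hmid : L / 2 ∈ Ioo 0 L := ⟨by linarith, by linarith⟩
  have hzi : ContinuousOn (fun s => (z s)⁻¹) (Ioo 0 L) :=
    hz.inv₀ fun s hs => (hpos s hs).ne'
  -- Travel time from the midpoint; the flow `X` is its inverse. The linear bounds on `z` make it
  -- diverge logarithmically at both ends.
  let T : ℝ → ℝ := fun s => ∫ x in (L / 2)..s, (z x)⁻¹
  have hTd : ∀ s ∈ Ioo 0 L, HasDerivAt T (z s)⁻¹ s := by
    intro s hs
    have hsub : uIcc (L / 2) s ⊆ Ioo 0 L := (ordConnected_Ioo).uIcc_subset hmid hs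
    exact intervalIntegral.integral_hasDerivAt_right ((hzi.mono hsub).intervalIntegrable)
      (hzi.stronglyMeasurableAtFilter isOpen_Ioo s hs)
      (hzi.continuousAt (isOpen_Ioo.mem_nhds hs))
  have hTc : ContinuousOn T (Ioo 0 L) := fun s hs => (hTd s hs).continuousAt.continuousWithinAt
  have hTmono : StrictMonoOn T (Ioo 0 L) := by
    apply strictMonoOn_of_deriv_pos (convex_Ioo 0 L) hTc
    intro s hs
    rw [interior_Ioo] at hs
    rw [(hTd s hs).deriv]
    exact inv_pos.2 (hpos s hs)
  have hlow : MonotoneOn (fun s => T s - C⁻¹ * Real.log s) (Ioo 0 L) := by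
    have hd : ∀ s ∈ Ioo 0 L, HasDerivAt (fun s => T s - C⁻¹ * Real.log s)
        ((z s)⁻¹ - C⁻¹ * s⁻¹) s := fun s hs =>
      (hTd s hs).sub ((Real.hasDerivAt_log hs.1.ne').const_mul _)
    apply monotoneOn_of_deriv_nonneg (convex_Ioo 0 L)
      (fun s hs => (hd s hs).continuousAt.continuousWithinAt)
    · intro s hs
      rw [interior_Ioo] at hs
      exact (hd s hs).differentiableAt.differentiableWithinAt
    · intro s hs
      rw [interior_Ioo] at hs
      rw [(hd s hs).deriv, ← mul_inv, sub_nonneg]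
      exact inv_anti₀ (hpos s hs) (hzC s hs)
  have hupp : MonotoneOn (fun s => T s + k⁻¹ * Real.log (L - s)) (Ioo 0 L) := by
    have hd : ∀ s ∈ Ioo 0 L, HasDerivAt (fun s => T s + k⁻¹ * Real.log (L - s))
        ((z s)⁻¹ + k⁻¹ * (-1 / (L - s))) s := fun s hs =>
      (hTd s hs).add ((((hasDerivAt_id s).const_sub L).log
        (by have := hs.2; simp only [id]; linarith)).const_mul _)
    apply monotoneOn_of_deriv_nonneg (convex_Ioo 0 L)
      (fun s hs => (hd s hs).continuousAt.continuousWithinAt)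
    · intro s hs
      rw [interior_Ioo] at hs
      exact (hd s hs).differentiableAt.differentiableWithinAt
    · intro s hs
      rw [interior_Ioo] at hs
      have h1 := inv_anti₀ (hpos s hs) (hzk s hs)
      rw [mul_inv] at h1
      rw [(hd s hs).deriv, neg_div, one_div]
      linarith
  have hTbot : Tendsto T (𝓝[>] 0) atBot := by
    have h1 : Tendsto (fun s => (T (L / 2) - C⁻¹ * Real.log (L / 2)) + C⁻¹ * Real.log s)
        (𝓝[>] 0) atBot :=
      tendsto_atBot_add_const_left _ _
        ((Real.tendsto_log_nhdsGT_zero).const_mul_atBot (inv_pos.2 hC))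
    refine tendsto_atBot_mono' _ ?_ h1
    filter_upwards [Ioo_mem_nhdsGT hmid.1] with s hs
    have := hlow ⟨hs.1, hs.2.trans hmid.2⟩ hmid hs.2.le
    simp only at this
    linarith
  have hTtop : Tendsto T (𝓝[<] L) atTop := by
    have h0 : Tendsto (fun s => L - s) (𝓝[<] L) (𝓝[>] 0) := by
      refine tendsto_nhdsWithin_iff.2 ⟨?_, ?_⟩
      · have : Tendsto (fun s => L - s) (𝓝 L) (𝓝 (L - L)) := by
          exact (continuous_const.sub continuous_id).tendsto L
        rw [sub_self] at this
        exact this.mono_left nhdsWithin_le_nhds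
      · filter_upwards [self_mem_nhdsWithin] with s hs
        exact sub_pos.2 (mem_Iio.1 hs)
    have h1 : Tendsto (fun s => (T (L / 2) + k⁻¹ * Real.log (L - L / 2)) +
        -(k⁻¹ * Real.log (L - s))) (𝓝[<] L) atTop :=
      tendsto_atTop_add_const_left _ _ (tendsto_neg_atBot_atTop.comp
        ((Real.tendsto_log_nhdsGT_zero.comp h0).const_mul_atBot (inv_pos.2 hk)))
    refine tendsto_atTop_mono' _ ?_ h1
    filter_upwards [Ioo_mem_nhdsLT hmid.2] with s hs
    have := hupp hmid ⟨hmid.1.trans hs.1, hs.2⟩ hs.1.le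
    simp only at this
    linarith
  have hsurj : SurjOn T (Ioo 0 L) univ := by
    intro t _
    obtain ⟨s₁, h₁, h₁'⟩ := ((hTbot.eventually (eventually_le_atBot t)).and
      (Ioo_mem_nhdsGT hL)).exists
    obtain ⟨s₂, h₂, h₂'⟩ := ((hTtop.eventually (eventually_ge_atTop t)).and
      (Ioo_mem_nhdsLT hL)).exists
    exact isPreconnected_Ioo.intermediate_value h₁' h₂' hTc ⟨h₁, h₂⟩
  choose X hX hTX using fun t : ℝ => hsurj (mem_univ t)
  have hXT : ∀ s ∈ Ioo 0 L, X (T s) = s := fun s hs =>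
    hTmono.injOn (hX _) hs (hTX _)
  have hXmono : StrictMono X := by
    intro a b hab
    rw [← hTX a, ← hTX b] at hab
    exact (hTmono.lt_iff_lt (hX a) (hX b)).1 hab
  have hXc : ∀ t, ContinuousAt X t := fun t =>
    (hXmono.strictMonoOn univ).continuousAt_of_image_mem_nhds univ_mem
      (mem_of_superset (isOpen_Ioo.mem_nhds (hX t)) fun s hs => ⟨T s, mem_univ _, hXT s hs⟩)
  refine ⟨X, hX, fun t => ?_, hXmono, ?_, ?_⟩
  · have := HasDerivAt.of_local_left_inverse (hXc t) (hTd _ (hX t))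
      (inv_ne_zero (hpos _ (hX t)).ne') (Eventually.of_forall hTX)
    rwa [inv_inv] at this
  · rw [Metric.tendsto_nhds]
    intro σ hσ
    have hm : min σ (L / 2) / 2 ∈ Ioo 0 L := by
      have := lt_min hσ hmid.1
      have := min_le_right σ (L / 2)
      constructor <;> linarith
    filter_upwards [eventually_le_atBot (T (min σ (L / 2) / 2))] with t ht
    have h1 := hXmono.monotone ht
    rw [hXT _ hm] at h1
    rw [Real.dist_eq, sub_zero, abs_of_pos (hX t).1]
    have := min_le_left σ (L / 2)
    linarith [hm.1]
  · rw [Metric.tendsto_nhds]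
    intro σ hσ
    have hm : L - min σ (L / 2) / 2 ∈ Ioo 0 L := by
      have := lt_min hσ hmid.1
      have := min_le_right σ (L / 2)
      constructor <;> linarith
    filter_upwards [eventually_ge_atTop (T (L - min σ (L / 2) / 2))] with t ht
    have h1 := hXmono.monotone ht
    rw [hXT _ hm] at h1
    rw [Real.dist_eq, abs_sub_comm, abs_of_pos (sub_pos.2 (hX t).2)]
    have := min_le_left σ (L / 2)
    linarith [hm.2]

/-! ### Convexity of `g` -/

section Flux

variable {f : ℝ → ℝ} {up um : ℝ}

lemma g_um : g f up um um = 0 := by simp [g]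

lemma g_up (hu : up < um) : g f up um up = 0 := by
  have : up - um ≠ 0 := by linarith
  simp only [g, speed]
  field_simp
  ring

lemma hasDerivAt_g (hf : ContDiff ℝ 2 f) (v : ℝ) :
    HasDerivAt (g f up um) (deriv f v - speed f up um) v := by
  have h1 : HasDerivAt f (deriv f v) v := (hf.differentiable (by norm_num) v).hasDerivAt
  refine ((h1.sub_const (f um)).fun_sub
    (((hasDerivAt_id v).sub_const um).const_mul (speed f up um))).congr_deriv ?_
  rw [mul_one]

lemma differentiable_g (hf : ContDiff ℝ 2 f) : Differentiable ℝ (g f up um) :=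
  fun v => (hasDerivAt_g hf v).differentiableAt

lemma strictMono_deriv_g (hf : ContDiff ℝ 2 f) (hconv : ∀ u : ℝ, 0 < deriv (deriv f) u) :
    StrictMono (deriv (g f up um)) := by
  have h1 : deriv (g f up um) = fun v => deriv f v - speed f up um :=
    funext fun v => (hasDerivAt_g hf v).deriv
  have h2 : StrictMono (deriv f) := strictMono_of_deriv_pos hconv
  intro a b hab
  simp only [h1]
  linarith [h2 hab]

lemma strictConvexOn_g (hf : ContDiff ℝ 2 f) (hconv : ∀ u : ℝ, 0 < deriv (deriv f) u) :
    StrictConvexOn ℝ univ (g f up um) := by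
  apply StrictMonoOn.strictConvexOn_of_deriv convex_univ (differentiable_g hf).continuous.continuousOn
  rw [interior_univ]
  exact (strictMono_deriv_g hf hconv).strictMonoOn univ

lemma g_neg (hf : ContDiff ℝ 2 f) (hconv : ∀ u : ℝ, 0 < deriv (deriv f) u) {v : ℝ}
    (hv : v ∈ Ioo up um) : g f up um v < 0 := by
  have hu := hv.1.trans hv.2
  have hL : 0 < um - up := by linarith
  have h := (strictConvexOn_g (up := up) (um := um) hf hconv).2 (mem_univ up) (mem_univ um) hu.ne
    (div_pos (sub_pos.2 hv.2) hL) (div_pos (sub_pos.2 hv.1) hL) (by field_simp; ring)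
  rw [g_um, g_up hu] at h
  have h2 : ((um - v) / (um - up)) • up + ((v - up) / (um - up)) • um = v := by
    simp only [smul_eq_mul]; field_simp; ring
  rw [h2] at h
  simpa using h

/-- The graph lies above its tangents. The tangent at `u₊` feeds the ray barrier, the one at `u₋`
the bound on the profile near `s = 0`. -/
lemma deriv_g_mul_le (hf : ContDiff ℝ 2 f) (hconv : ∀ u : ℝ, 0 < deriv (deriv f) u) (x v : ℝ) :
    g f up um x + deriv (g f up um) x * (v - x) ≤ g f up um v := by
  have hc := (strictConvexOn_g (up := up) (um := um) hf hconv).convexOn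
  have hd := differentiable_g (up := up) (um := um) hf x
  rcases lt_trichotomy x v with h | rfl | h
  · have := hc.deriv_le_slope (mem_univ x) (mem_univ v) h hd
    rw [slope_def_field, le_div_iff₀ (sub_pos.2 h)] at this
    linarith
  · simp
  · have := hc.slope_le_deriv (mem_univ v) (mem_univ x) h hd
    rw [slope_def_field, div_le_iff₀ (sub_pos.2 h)] at this
    linarith

lemma deriv_g_up_neg (hf : ContDiff ℝ 2 f) (hconv : ∀ u : ℝ, 0 < deriv (deriv f) u)
    (hu : up < um) : deriv (g f up um) up < 0 := by
  have hm : (up + um) / 2 ∈ Ioo up um := ⟨by linarith, by linarith⟩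
  have h1 := deriv_g_mul_le (up := up) (um := um) hf hconv up ((up + um) / 2)
  have h2 := g_neg hf hconv hm
  rw [g_up hu] at h1
  by_contra! h
  have : 0 ≤ deriv (g f up um) up * ((up + um) / 2 - up) := mul_nonneg h (by linarith)
  linarith

lemma deriv_g_um_pos (hf : ContDiff ℝ 2 f) (hconv : ∀ u : ℝ, 0 < deriv (deriv f) u)
    (hu : up < um) : 0 < deriv (g f up um) um := by
  have hm : (up + um) / 2 ∈ Ioo up um := ⟨by linarith, by linarith⟩
  have h1 := deriv_g_mul_le (up := up) (um := um) hf hconv um ((up + um) / 2)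
  have h2 := g_neg hf hconv hm
  rw [g_um] at h1
  by_contra! h
  have : 0 ≤ deriv (g f up um) um * ((up + um) / 2 - um) :=
    mul_nonneg_of_nonpos_of_nonpos h (by linarith)
  linarith

lemma neg_g_le_S (hf : ContDiff ℝ 2 f) {v : ℝ} (hv : v ∈ Icc up um) :
    -g f up um v ≤ S f up um :=
  le_csSup ((isCompact_Icc.image (differentiable_g hf).continuous.neg).bddAbove)
    (mem_image_of_mem _ hv)

lemma S_pos (hf : ContDiff ℝ 2 f) (hconv : ∀ u : ℝ, 0 < deriv (deriv f) u) (hu : up < um) :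
    0 < S f up um := by
  have hm : (up + um) / 2 ∈ Ioo up um := ⟨by linarith, by linarith⟩
  linarith [g_neg hf hconv hm, neg_g_le_S hf (Ioo_subset_Icc_self hm)]

end Flux

/-! ### The friction law -/

section Friction

variable {α : ℝ}

/-- The friction law `z ↦ z / (1 + z²)^α`. -/
noncomputable def friction (α z : ℝ) : ℝ := z / (1 + z ^ 2) ^ α

lemma friction_eq_mul (α z : ℝ) : friction α z = z * (1 + z ^ 2) ^ (-α) := by
  rw [friction, Real.rpow_neg (by positivity), div_eq_mul_inv]

lemma friction_neg (α z : ℝ) : friction α (-z) = -friction α z := by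
  simp [friction, neg_div]

lemma hasDerivAt_friction (α z : ℝ) :
    HasDerivAt (friction α) ((1 + z ^ 2) ^ (-α - 1) * (1 + z ^ 2 - 2 * α * z ^ 2)) z := by
  have hz : 0 < 1 + z ^ 2 := by positivity
  have h1 : HasDerivAt (fun z : ℝ => 1 + z ^ 2) (2 * z) z := by
    simpa using ((hasDerivAt_id z).pow 2).const_add 1
  have h2 := (hasDerivAt_id z).fun_mul (h1.rpow_const (p := -α) (Or.inl hz.ne'))
  have h3 : friction α = fun z => id z * (1 + z ^ 2) ^ (-α) := funext fun z => friction_eq_mul α z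
  rw [h3]
  refine h2.congr_deriv ?_
  have h4 : (1 + z ^ 2) ^ (-α) = (1 + z ^ 2) ^ (-α - 1) * (1 + z ^ 2) := by
    rw [Real.rpow_sub_one hz.ne']; field_simp
  rw [h4]
  simp only [id]
  ring

lemma differentiable_friction (α : ℝ) : Differentiable ℝ (friction α) :=
  fun z => (hasDerivAt_friction α z).differentiableAt

lemma deriv_friction_mem (hα : 0 ≤ α) (z : ℝ) :
    -(2 * α) ≤ (1 + z ^ 2) ^ (-α - 1) * (1 + z ^ 2 - 2 * α * z ^ 2) ∧
      (1 + z ^ 2) ^ (-α - 1) * (1 + z ^ 2 - 2 * α * z ^ 2) ≤ 1 := by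
  have hz : 0 < 1 + z ^ 2 := by positivity
  set r := (1 + z ^ 2) ^ (-α - 1) with hr
  have hr0 : 0 < r := Real.rpow_pos_of_pos hz _
  have h4 : (1 + z ^ 2) ^ (-α) = r * (1 + z ^ 2) := by
    rw [hr, Real.rpow_sub_one hz.ne']; field_simp
  have h5 : r * (1 + z ^ 2) ≤ 1 := by
    rw [← h4]
    exact Real.rpow_le_one_of_one_le_of_nonpos (by nlinarith [sq_nonneg z]) (by linarith)
  have h6 : 0 ≤ r * z ^ 2 := by positivity
  have h7 : r * z ^ 2 ≤ 1 := by nlinarith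
  have h8 : α * (r * z ^ 2) ≤ α * 1 := mul_le_mul_of_nonneg_left h7 hα
  have h9 : 0 ≤ α * (r * z ^ 2) := by positivity
  have h10 : 0 ≤ r * (1 + z ^ 2) := by positivity
  constructor <;> nlinarith

lemma lipschitzWith_friction (hα : 0 ≤ α) :
    LipschitzWith (Real.toNNReal (1 + 2 * α)) (friction α) := by
  refine lipschitzWith_of_nnnorm_deriv_le (differentiable_friction α) fun z => ?_
  rw [← NNReal.coe_le_coe, coe_nnnorm, Real.coe_toNNReal _ (by linarith),
    (hasDerivAt_friction α z).deriv, Real.norm_eq_abs, abs_le]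
  have := deriv_friction_mem hα z
  constructor <;> linarith [this.1, this.2]

/-- Beyond its maximum the friction may decrease, but with slope at least `-2α`; this one-sided
bound suffices for the barrier at `z₀`. -/
lemma friction_sub_le (hα : 0 ≤ α) {a b : ℝ} (hab : a ≤ b) :
    friction α a - friction α b ≤ 2 * α * (b - a) := by
  have hd : ∀ z, HasDerivAt (fun z => friction α z + 2 * α * z)
      ((1 + z ^ 2) ^ (-α - 1) * (1 + z ^ 2 - 2 * α * z ^ 2) + 2 * α) z := fun z => by
    simpa using (hasDerivAt_friction α z).fun_add ((hasDerivAt_id z).const_mul (2 * α))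
  have hm : Monotone (fun z => friction α z + 2 * α * z) := by
    apply monotone_of_deriv_nonneg (fun z => (hd z).differentiableAt)
    intro z
    rw [(hd z).deriv]
    linarith [(deriv_friction_mem hα z).1]
  have := hm hab
  simp only at this
  linarith

/-- The derivative has the sign of `1 - (2α - 1)z²`. -/
lemma monotoneOn_friction {z₀ : ℝ} (hz : (2 * α - 1) * z₀ ^ 2 ≤ 1) :
    MonotoneOn (friction α) (Icc 0 z₀) := by
  apply monotoneOn_of_deriv_nonneg (convex_Icc 0 z₀)
    (differentiable_friction α).continuous.continuousOn (differentiable_friction α).differentiableOn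
  intro z hz'
  rw [interior_Icc] at hz'
  rw [(hasDerivAt_friction α z).deriv]
  refine mul_nonneg (Real.rpow_nonneg (by positivity) _) ?_
  have h1 : z ^ 2 ≤ z₀ ^ 2 := pow_le_pow_left₀ hz'.1.le hz'.2.le 2
  rcases le_total (2 * α - 1) 0 with h | h
  · nlinarith [sq_nonneg z, mul_nonneg (sub_nonneg.2 h) (sq_nonneg z)]
  · nlinarith [mul_le_mul_of_nonneg_left h1 h]

lemma mul_le_friction (hα : 0 ≤ α) {z z₀ : ℝ} (h0 : 0 ≤ z) (h : z ≤ z₀) :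
    (1 + z₀ ^ 2) ^ (-α) * z ≤ friction α z := by
  rw [friction_eq_mul, mul_comm]
  refine mul_le_mul_of_nonneg_left ?_ h0
  have h1 : z ^ 2 ≤ z₀ ^ 2 := pow_le_pow_left₀ h0 h 2
  exact Real.rpow_le_rpow_of_nonpos (by positivity) (by linarith) (by linarith)

/-- For `α > 1/2` the friction peaks at `1/√(2α - 1)`, so `epsMin` is `S` divided by the peak value.
-/
lemma friction_critical (hα : 1 / 2 < α) :
    friction α (1 / Real.sqrt (2 * α - 1)) *
      (2 ^ α * (α / (2 * α - 1)) ^ α * Real.sqrt (2 * α - 1)) = 1 := by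
  have h : 0 < 2 * α - 1 := by linarith
  have hs : 0 < Real.sqrt (2 * α - 1) := Real.sqrt_pos.2 h
  have h1 : 1 + (1 / Real.sqrt (2 * α - 1)) ^ 2 = 2 * (α / (2 * α - 1)) := by
    rw [div_pow, Real.sq_sqrt h.le]
    field_simp
    ring
  rw [friction, h1, Real.mul_rpow (by norm_num) (by apply div_nonneg <;> linarith)]
  have h2 : 0 < (2:ℝ) ^ α := by positivity
  have h3 : 0 < (α / (2 * α - 1)) ^ α := Real.rpow_pos_of_pos (div_pos (by linarith) h) _
  field_simp

lemma tendsto_friction_half : Tendsto (friction (1 / 2)) atTop (𝓝 1) := by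
  have h1 : Tendsto (fun z : ℝ => 1 / (1 + (z⁻¹) ^ 2) ^ (1 / 2 : ℝ)) atTop (𝓝 1) := by
    have h0 : Tendsto (fun z : ℝ => 1 + (z⁻¹) ^ 2) atTop (𝓝 (1 + 0 ^ 2)) :=
      (tendsto_inv_atTop_zero.pow 2).const_add 1
    have h2 := (h0.rpow_const (p := (1 / 2 : ℝ)) (Or.inl (by norm_num)))
    have h3 := (tendsto_const_nhds (x := (1:ℝ))).div h2 (by norm_num)
    rw [zero_pow two_ne_zero, add_zero, Real.one_rpow, div_one] at h3
    exact h3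
  refine h1.congr' ?_
  filter_upwards [eventually_gt_atTop 0] with z hz
  have h2 : 1 + z ^ 2 = z ^ 2 * (1 + (z⁻¹) ^ 2) := by field_simp; ring
  have h3 : 0 < (1 + (z⁻¹) ^ 2) ^ (1 / 2 : ℝ) := by positivity
  rw [friction, h2, Real.mul_rpow (by positivity) (by positivity), ← Real.sqrt_eq_rpow (z ^ 2),
    Real.sqrt_sq hz.le]
  field_simp

lemma tendsto_friction_atTop (hα : 0 ≤ α) (hα' : α < 1 / 2) :
    Tendsto (friction α) atTop atTop := by
  have h1 : Tendsto (fun z : ℝ => (2 ^ α)⁻¹ * z ^ (1 - 2 * α)) atTop atTop :=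
    (tendsto_rpow_atTop (by linarith)).const_mul_atTop (by positivity)
  refine tendsto_atTop_mono' _ ?_ h1
  filter_upwards [eventually_ge_atTop 1] with z hz
  have hz0 : 0 < z := by linarith
  have h2 : (1 + z ^ 2) ^ α ≤ 2 ^ α * z ^ (2 * α) := by
    rw [Real.rpow_mul hz0.le, ← Real.mul_rpow (by norm_num) (by positivity)]
    refine Real.rpow_le_rpow (by positivity) ?_ hα
    rw [Real.rpow_two]
    nlinarith
  rw [friction, Real.rpow_sub hz0, Real.rpow_one, inv_mul_eq_div, div_div, mul_comm (z ^ (2 * α))]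
  exact div_le_div_of_nonneg_left hz0.le (by positivity) h2

end Friction

/-! ### The threshold on `ε` -/

/-- Above the threshold, the friction balances the driving force `S` at some slope `z₀` below which
the friction law is monotone. -/
lemma exists_balancing_slope {f : ℝ → ℝ} {up um α ε : ℝ} (hα : 0 ≤ α) (hS : 0 < S f up um)
    (hε : threshold f up um α < ε ∨ (1 / 2 < α ∧ ε = epsMin f up um α)) :
    0 < ε ∧ ∃ z₀ : ℝ, 0 < z₀ ∧ (2 * α - 1) * z₀ ^ 2 ≤ 1 ∧ S f up um ≤ ε * friction α z₀ := by
  rcases lt_trichotomy α (1 / 2) with h | rfl | h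
  · have hε0 : 0 < ε := by
      rcases hε with h' | h'
      · rwa [threshold, if_neg (not_lt.2 h.le), if_neg h.ne] at h'
      · exact absurd h'.1 (not_lt.2 h.le)
    refine ⟨hε0, ?_⟩
    obtain ⟨z, hz, hz'⟩ := (((tendsto_friction_atTop hα h).eventually
      (eventually_ge_atTop (S f up um / ε))).and (eventually_gt_atTop 0)).exists
    refine ⟨z, hz', ?_, ?_⟩
    · nlinarith [sq_nonneg z, mul_nonneg (sub_nonneg.2 h.le) (sq_nonneg z)]
    · rw [div_le_iff₀ hε0] at hz
      linarith
  · have hε' : S f up um < ε := by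
      rcases hε with h' | h'
      · simpa [threshold] using h'
      · exact absurd h'.1 (lt_irrefl _)
    have hε0 : 0 < ε := hS.trans hε'
    refine ⟨hε0, ?_⟩
    obtain ⟨z, hz, hz'⟩ := ((tendsto_friction_half.eventually
      (lt_mem_nhds ((div_lt_one hε0).2 hε'))).and (eventually_gt_atTop 0)).exists
    refine ⟨z, hz', by norm_num, ?_⟩
    rw [div_lt_iff₀ hε0] at hz
    linarith
  · have hε' : epsMin f up um α ≤ ε := by
      rcases hε with h' | h'
      · simp only [threshold, if_pos h] at h'
        exact h'.le
      · exact h'.2.ge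
    have h2 : 0 < 2 * α - 1 := by linarith
    have hs : 0 < Real.sqrt (2 * α - 1) := Real.sqrt_pos.2 h2
    have hE : epsMin f up um α * friction α (1 / Real.sqrt (2 * α - 1)) = S f up um := by
      have := friction_critical h
      rw [epsMin]
      linear_combination (S f up um) * this
    have hp : 0 < friction α (1 / Real.sqrt (2 * α - 1)) := by
      rw [friction]; positivity
    refine ⟨lt_of_lt_of_le (pos_of_mul_pos_left (hE ▸ hS) hp.le) hε', 1 / Real.sqrt (2 * α - 1),
      by positivity, ?_, ?_⟩
    · rw [div_pow, Real.sq_sqrt h2.le]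
      apply le_of_eq
      field_simp
    · rw [← hE]
      exact mul_le_mul_of_nonneg_right hε' hp.le

/-- With `x = 2a - 1`, the factors `x^(-a)` and `√x` combine to `exp(-(x log x)/2)`, and `x log x`
is continuous at `0`. -/
lemma tendsto_epsMin (f : ℝ → ℝ) (up um : ℝ) :
    Tendsto (fun a : ℝ => epsMin f up um a) (𝓝[>] (1 / 2)) (𝓝 (S f up um)) := by
  have h1 : Continuous fun a : ℝ =>
      Real.exp (a * Real.log 2 - ((2 * a - 1) * Real.log (2 * a - 1)) / 2) := by
    have := Real.continuous_mul_log.comp (by fun_prop : Continuous fun a : ℝ => 2 * a - 1)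
    simp only [Function.comp_def] at this
    fun_prop
  have h2 : ContinuousAt (fun a : ℝ => S f up um * a ^ a *
      Real.exp (a * Real.log 2 - ((2 * a - 1) * Real.log (2 * a - 1)) / 2)) (1 / 2) := by
    refine ContinuousAt.mul (continuousAt_const.mul ?_) h1.continuousAt
    exact continuousAt_id.rpow continuousAt_id (Or.inl (by norm_num))
  have h3 : Tendsto _ _ _ := h2.tendsto
  have h4 : S f up um * (1 / 2 : ℝ) ^ (1 / 2 : ℝ) * Real.exp ((1 / 2) * Real.log 2 -
      ((2 * (1 / 2) - 1) * Real.log (2 * (1 / 2) - 1)) / 2) = S f up um := by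
    rw [Real.rpow_def_of_pos (by norm_num), mul_assoc, ← Real.exp_add, one_div, Real.log_inv]
    have : -Real.log 2 * 2⁻¹ + (2⁻¹ * Real.log 2 -
        (2 * 2⁻¹ - 1) * Real.log (2 * 2⁻¹ - 1) / 2) = 0 := by norm_num; ring
    rw [this, Real.exp_zero, mul_one]
  rw [h4] at h3
  refine (h3.mono_left nhdsWithin_le_nhds).congr' ?_
  filter_upwards [self_mem_nhdsWithin] with a ha
  have ha' : (1 / 2 : ℝ) < a := ha
  have hx : 0 < 2 * a - 1 := by linarith
  rw [epsMin, Real.div_rpow (by linarith) hx.le, Real.sqrt_eq_rpow,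
    Real.rpow_def_of_pos (by norm_num : (0:ℝ) < 2), Real.rpow_def_of_pos hx,
    Real.rpow_def_of_pos hx, div_eq_mul_inv (a ^ a), ← Real.exp_neg]
  have h5 : a * Real.log 2 - (2 * a - 1) * Real.log (2 * a - 1) / 2 =
      Real.log 2 * a + (-(Real.log (2 * a - 1) * a) + Real.log (2 * a - 1) * (1 / 2)) := by ring
  rw [h5, Real.exp_add, Real.exp_add]
  ring

/-! ### The square-root nonlinearity -/

lemma sqrt_sub_sqrt_le (x y : ℝ) : Real.sqrt x - Real.sqrt y ≤ Real.sqrt |x - y| := by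
  rw [sub_le_iff_le_add, Real.sqrt_le_iff]
  refine ⟨by positivity, ?_⟩
  have h1 : y ≤ Real.sqrt y ^ 2 := by
    rcases le_total 0 y with h | h
    · rw [Real.sq_sqrt h]
    · exact h.trans (sq_nonneg _)
  have h2 : Real.sqrt |x - y| ^ 2 = |x - y| := Real.sq_sqrt (abs_nonneg _)
  nlinarith [le_abs_self (x - y), mul_nonneg (Real.sqrt_nonneg y) (Real.sqrt_nonneg |x - y|)]

lemma uniformContinuous_sqrt : UniformContinuous Real.sqrt := by
  rw [Metric.uniformContinuous_iff]
  intro σ hσ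
  refine ⟨σ ^ 2, by positivity, fun {x y} h => ?_⟩
  rw [Real.dist_eq] at h ⊢
  have h1 : Real.sqrt |x - y| < σ := by
    rw [Real.sqrt_lt' hσ]
    exact h
  have h2 := sqrt_sub_sqrt_le y x
  rw [abs_sub_comm] at h2
  rw [abs_lt]
  constructor <;> linarith [sqrt_sub_sqrt_le x y]

/-- Cutting the root off below at `b` removes its singularity at `0` while keeping it monotone and
within `b` of the original. -/
lemma lipschitzWith_max_sqrt {b : ℝ} (hb : 0 < b) :
    LipschitzWith (Real.toNNReal b⁻¹) fun x => max (Real.sqrt x) b := by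
  have aux : ∀ x y : ℝ, x ≤ y → max (Real.sqrt y) b - max (Real.sqrt x) b ≤ b⁻¹ * (y - x) := by
    intro x y hxy
    have hp : b ≤ max (Real.sqrt x) b := le_max_right _ _
    rcases le_total (Real.sqrt y) b with h | h
    · rw [max_eq_right h]
      have : 0 ≤ b⁻¹ * (y - x) := mul_nonneg (inv_nonneg.2 hb.le) (by linarith)
      linarith
    · rw [max_eq_left h, inv_mul_eq_div, le_div_iff₀ hb]
      have hy : 0 ≤ y := by
        by_contra! h0
        rw [Real.sqrt_eq_zero_of_nonpos h0.le] at h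
        linarith
      have hx : x ≤ max (Real.sqrt x) b ^ 2 := by
        rcases le_total 0 x with h0 | h0
        · calc x = Real.sqrt x ^ 2 := (Real.sq_sqrt h0).symm
            _ ≤ _ := pow_le_pow_left₀ (Real.sqrt_nonneg x) (le_max_left _ _) 2
        · exact h0.trans (sq_nonneg _)
      have hle : max (Real.sqrt x) b ≤ Real.sqrt y := max_le (Real.sqrt_le_sqrt hxy) h
      have hy2 := Real.sq_sqrt hy
      have h3 := mul_le_mul_of_nonneg_left (show b ≤ Real.sqrt y + max (Real.sqrt x) b by
        linarith) (sub_nonneg.2 hle)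
      nlinarith
  refine LipschitzWith.of_dist_le_mul fun x y => ?_
  rw [Real.dist_eq, Real.dist_eq, Real.coe_toNNReal _ (inv_nonneg.2 hb.le)]
  rcases le_total x y with h | h
  · rw [abs_sub_comm, abs_sub_comm x, abs_of_nonneg (sub_nonneg.2 h), abs_of_nonneg]
    · exact aux x y h
    · exact sub_nonneg.2 (max_le_max (Real.sqrt_le_sqrt h) le_rfl)
  · rw [abs_of_nonneg (sub_nonneg.2 h), abs_of_nonneg]
    · exact aux y x h
    · exact sub_nonneg.2 (max_le_max (Real.sqrt_le_sqrt h) le_rfl)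

/-- Existence for `y' = G(s) - c φ(min(√y, z₀))`, `y(0) = 0`, with `φ` the friction law. -/
lemma exists_solution_friction {α z₀ c L : ℝ} (hα : 0 ≤ α) (hz₀ : 0 < z₀)
    (hcrit : (2 * α - 1) * z₀ ^ 2 ≤ 1) (hc : 0 ≤ c) (hL : 0 ≤ L) {G : ℝ → ℝ}
    (hG : Continuous G) :
    ∃ y : ℝ → ℝ, y 0 = 0 ∧ ContinuousOn y (Icc 0 L) ∧
      ∀ s ∈ Ioo 0 L, HasDerivAt y (G s - c * friction α (min (Real.sqrt (y s)) z₀)) s := by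
  have hmono := monotoneOn_friction hcrit
  have hlip := lipschitzWith_friction hα
  have hb : ∀ n : ℕ, 0 < 1 / ((n : ℝ) + 1) := fun n => Nat.one_div_pos_of_nat
  have hlipc : LipschitzWith (Real.toNNReal c * Real.toNNReal (1 + 2 * α))
      (fun x => c * friction α x) := by
    refine LipschitzWith.of_dist_le_mul fun x y => ?_
    have := hlip.dist_le_mul x y
    rw [Real.dist_eq] at this ⊢
    rw [← mul_sub, abs_mul, abs_of_nonneg hc, NNReal.coe_mul, Real.coe_toNNReal _ hc, mul_assoc]
    exact mul_le_mul_of_nonneg_left this hc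
  have hmin : LipschitzWith 1 (fun x : ℝ => min x z₀) := LipschitzWith.id.min_const z₀
  -- Replacing `√x` by `max (√x) (1/(n+1))` gives Lipschitz approximations; the cap at `z₀` keeps
  -- the friction in its increasing range.
  refine exists_solution_of_monotone hL hG (h := fun x => c * friction α (min (Real.sqrt x) z₀))
    (B := c * friction α z₀)
    (H := fun n x => c * friction α (min (max (Real.sqrt x) (1 / ((n : ℝ) + 1))) z₀))
    (a := fun n => (c * (1 + 2 * α)) * (1 / ((n : ℝ) + 1)))
    ?_ ?_ (fun n => (hlipc.comp hmin).comp (lipschitzWith_max_sqrt (hb n))) ?_ ?_ ?_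
  · exact ((hlipc.comp hmin).uniformContinuous).comp uniformContinuous_sqrt
  · intro x
    have hmem : min (Real.sqrt x) z₀ ∈ Icc 0 z₀ :=
      ⟨le_min (Real.sqrt_nonneg x) hz₀.le, min_le_right _ _⟩
    have h1 := hmono hmem ⟨hz₀.le, le_rfl⟩ hmem.2
    have h0 : 0 ≤ friction α (min (Real.sqrt x) z₀) := by
      have := hmono ⟨le_rfl, hz₀.le⟩ hmem hmem.1
      simpa [friction] using this
    rw [abs_of_nonneg (mul_nonneg hc h0)]
    exact mul_le_mul_of_nonneg_left h1 hc
  · intro n x y hxy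
    have hmem : ∀ x, min (max (Real.sqrt x) (1 / ((n : ℝ) + 1))) z₀ ∈ Icc 0 z₀ := fun x =>
      ⟨le_min ((Real.sqrt_nonneg x).trans (le_max_left _ _)) hz₀.le, min_le_right _ _⟩
    refine mul_le_mul_of_nonneg_left (hmono (hmem x) (hmem y) ?_) hc
    exact min_le_min (max_le_max (Real.sqrt_le_sqrt hxy) le_rfl) le_rfl
  · intro n x
    have h1 := (hlipc.comp hmin).dist_le_mul (max (Real.sqrt x) (1 / ((n : ℝ) + 1))) (Real.sqrt x)
    rw [Real.dist_eq, Real.dist_eq, mul_one, NNReal.coe_mul, Real.coe_toNNReal _ hc,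
      Real.coe_toNNReal _ (by linarith)] at h1
    refine h1.trans (mul_le_mul_of_nonneg_left ?_ (mul_nonneg hc (by linarith)))
    rw [abs_of_nonneg (sub_nonneg.2 (le_max_left _ _)), sub_le_iff_le_add]
    exact max_le (by linarith [(hb n).le]) (by linarith [Real.sqrt_nonneg x])
  · simpa using tendsto_one_div_add_atTop_nhds_zero_nat.const_mul (c * (1 + 2 * α))

/-! ### Existence of the wave -/

section Existence

variable {f : ℝ → ℝ} {up um α ε δ z₀ k : ℝ}

/-- The barrier inequality on the ray of slope `k` through `(u₊, 0)`. -/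
lemma ray_barrier (hf : ContDiff ℝ 2 f) (hconv : ∀ u : ℝ, 0 < deriv (deriv f) u) (hu : up < um)
    (hα : 0 ≤ α) (hε : 0 < ε) (hδ : 0 < δ) (hk : 0 < k)
    (hkδ : -deriv (g f up um) up / k + k * δ < ε * (1 + z₀ ^ 2) ^ (-α)) {v z : ℝ}
    (hz : 0 < z) (hzz : z ≤ z₀) (hray : k * (v - up) ≤ z) :
    (1 / δ) * (-g f up um v - ε * friction α z) + k * z ≤ 0 := by
  have hm := deriv_g_up_neg hf hconv hu
  set m := -deriv (g f up um) up with hmdef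
  have h1 := deriv_g_mul_le (up := up) (um := um) hf hconv up v
  rw [g_up hu] at h1
  have h2 := mul_le_mul_of_nonneg_left (mul_le_friction hα hz.le hzz) hε.le
  -- On or above the ray, driving force and ray motion are both linear in `z`, with slopes `m/k` and
  -- `kδ`; `hkδ` says that friction beats their sum.
  have h3 : m * (v - up) ≤ m / k * z := by
    have hm0 : 0 ≤ m := by linarith
    have := mul_le_mul_of_nonneg_left hray (div_nonneg hm0 hk.le)
    calc m * (v - up) = m / k * (k * (v - up)) := by field_simp
      _ ≤ _ := this
  have h4 := mul_le_mul_of_nonneg_right hkδ.le hz.le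
  have h5 : -g f up um v - ε * friction α z + δ * (k * z) ≤ 0 := by nlinarith
  calc (1 / δ) * (-g f up um v - ε * friction α z) + k * z
      = (1 / δ) * (-g f up um v - ε * friction α z + δ * (k * z)) := by field_simp
    _ ≤ 0 := mul_nonpos_of_nonneg_of_nonpos (by positivity) h5

/-- The profile `y = w²` of the wave as a function of `s = u₋ - v`. -/
lemma exists_profile (hf : ContDiff ℝ 2 f) (hconv : ∀ u : ℝ, 0 < deriv (deriv f) u)
    (hu : up < um) (hα : 0 ≤ α) (hε : 0 < ε) (hδ : 0 < δ) (hz₀ : 0 < z₀)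
    (hcrit : (2 * α - 1) * z₀ ^ 2 ≤ 1) (hS : S f up um ≤ ε * friction α z₀) (hk : 0 < k)
    (hkδ : -deriv (g f up um) up / k + k * δ < ε * (1 + z₀ ^ 2) ^ (-α)) :
    ∃ y : ℝ → ℝ, ∀ s ∈ Ioo 0 (um - up), 0 < y s ∧ Real.sqrt (y s) ≤ k * (um - up - s) ∧
      y s ≤ deriv (g f up um) um / δ * s ^ 2 ∧
      HasDerivAt y ((2 / δ) * (-g f up um (um - s) - ε * friction α (Real.sqrt (y s)))) s := by
  set L := um - up with hLdef
  have hL : 0 < L := sub_pos.2 hu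
  have hgc : Continuous (g f up um) := (differentiable_g hf).continuous
  obtain ⟨y, hy0, hyc, hyd'⟩ := exists_solution_friction (c := 2 / δ * ε) (L := L)
    (G := fun s => 2 / δ * -g f up um (um - s)) hα hz₀ hcrit (by positivity) hL.le
    (by fun_prop)
  have hyd : ∀ s ∈ Ioo 0 L, HasDerivAt y ((2 / δ) * (-g f up um (um - s) -
      ε * friction α (min (Real.sqrt (y s)) z₀))) s := fun s hs =>
    (hyd' s hs).congr_deriv (by ring)
  have hG : ∀ s ∈ Ioo 0 L, g f up um (um - s) < 0 := fun s hs =>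
    g_neg hf hconv ⟨by linarith [hs.2], by linarith [hs.1]⟩
  have hsub : ∀ b ∈ Ioo 0 L, ∀ s ∈ Ioo 0 b, s ∈ Ioo 0 L := fun b hb s hs =>
    ⟨hs.1, hs.2.trans hb.2⟩
  have hc2 : 0 < 2 / δ := by positivity
  -- Where `y < 0`, `Real.sqrt` is `0`, so friction vanishes and the driving force pushes `y` up.
  have hnn : ∀ s ∈ Ioo 0 L, 0 ≤ y s := by
    intro b hb
    have key := nonpos_of_deriv_nonpos_of_pos (y := fun s => -y s) hb.1.le
      ((hyc.mono (Icc_subset_Icc_right hb.2.le)).neg)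
      (fun s hs => (hyd s (hsub b hb s hs)).neg)
      (fun s hs hpos => by
        rw [Real.sqrt_eq_zero_of_nonpos (by linarith), min_eq_left hz₀.le]
        have := hG s (hsub b hb s hs)
        have h2 : 0 ≤ 2 / δ * -g f up um (um - s) := mul_nonneg hc2.le (by linarith)
        simpa [friction] using h2) (by simp [hy0])
    simpa using key
  have hpos : ∀ s ∈ Ioo 0 L, 0 < y s := by
    intro s hs
    -- An interior zero would be a minimum, yet the derivative there is positive.
    refine lt_of_le_of_ne (hnn s hs) fun h0 => ?_
    have hmin : IsLocalMin y s := by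
      filter_upwards [isOpen_Ioo.mem_nhds hs] with t ht
      rw [← h0]
      exact hnn t ht
    have h1 := hmin.hasDerivAt_eq_zero (hyd s hs)
    rw [← h0, Real.sqrt_zero, min_eq_left hz₀.le] at h1
    have h2 := hG s hs
    have h3 : 0 < 2 / δ * -g f up um (um - s) := mul_pos hc2 (by linarith)
    simp only [friction, zero_div, mul_zero, sub_zero] at h1
    linarith
  -- Above `z₀²` the capped friction is frozen at `φ(z₀)`, which balances `S`; hence the cap is
  -- inactive along `y`.
  have hle : ∀ s ∈ Ioo 0 L, y s ≤ z₀ ^ 2 := by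
    intro b hb
    have key := nonpos_of_deriv_nonpos_of_pos (y := fun s => y s - z₀ ^ 2) hb.1.le
      ((hyc.mono (Icc_subset_Icc_right hb.2.le)).sub continuousOn_const)
      (fun s hs => (hyd s (hsub b hb s hs)).sub_const _)
      (fun s hs hp => by
        have h1 : z₀ ≤ Real.sqrt (y s) := Real.le_sqrt_of_sq_le (by linarith)
        rw [min_eq_right h1]
        have hs' := hsub b hb s hs
        have := neg_g_le_S (up := up) (um := um) hf
          (v := um - s) ⟨by linarith [hs'.2], by linarith [hs'.1]⟩
        exact mul_nonpos_of_nonneg_of_nonpos hc2.le (by linarith))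
      (by simp only [hy0]; nlinarith)
    linarith
  have hsqrt : ∀ s ∈ Ioo 0 L, Real.sqrt (y s) ≤ z₀ := fun s hs =>
    Real.sqrt_le_iff.2 ⟨hz₀.le, hle s hs⟩
  have hyd₂ : ∀ s ∈ Ioo 0 L, HasDerivAt y ((2 / δ) * (-g f up um (um - s) -
      ε * friction α (Real.sqrt (y s)))) s := fun s hs => by
    have := hyd s hs
    rwa [min_eq_left (hsqrt s hs)] at this
  refine ⟨y, fun s hs => ⟨hpos s hs, ?_, ?_, hyd₂ s hs⟩⟩
  · have key := nonpos_of_deriv_nonpos_of_pos (y := fun t => y t - (k * (L - t)) ^ 2)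
      (y' := fun t => (2 / δ) * (-g f up um (um - t) - ε * friction α (Real.sqrt (y t))) +
        2 * k * (k * (L - t))) hs.1.le
      ((hyc.mono (Icc_subset_Icc_right hs.2.le)).sub (by fun_prop))
      (fun t ht => by
        have h1 : HasDerivAt (fun t => (k * (L - t)) ^ 2) (-(2 * k * (k * (L - t)))) t := by
          refine ((((hasDerivAt_id t).const_sub L).const_mul k).pow 2).congr_deriv ?_
          simp only [id]
          ring
        exact ((hyd₂ t (hsub s hs t ht)).fun_sub h1).congr_deriv (by ring))
      (fun t ht hp => by
        have ht' := hsub s hs t ht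
        have hlt : k * (L - t) < Real.sqrt (y t) := Real.lt_sqrt_of_sq_lt (by linarith)
        have hb := ray_barrier hf hconv hu hα hε hδ hk hkδ (v := um - t)
          (Real.sqrt_pos.2 (hpos t ht')) (hsqrt t ht')
          (by rw [hLdef] at hlt; nlinarith)
        have h2 := mul_lt_mul_of_pos_left hlt hk
        have h3 : (2 / δ) * (-g f up um (um - t) - ε * friction α (Real.sqrt (y t))) =
          2 * ((1 / δ) * (-g f up um (um - t) - ε * friction α (Real.sqrt (y t)))) := by ring
        rw [h3]
        linarith)
      (by simp only [hy0, zero_sub]; nlinarith [sq_nonneg (k * (L - 0))])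
    rw [Real.sqrt_le_iff]
    exact ⟨mul_nonneg hk.le (by linarith [hs.2]), by linarith⟩
  · have key := nonpos_of_deriv_nonpos_of_pos
      (y := fun t => y t - deriv (g f up um) um / δ * t ^ 2)
      (y' := fun t => (2 / δ) * (-g f up um (um - t) - ε * friction α (Real.sqrt (y t))) -
        deriv (g f up um) um / δ * (2 * t)) hs.1.le
      ((hyc.mono (Icc_subset_Icc_right hs.2.le)).sub (by fun_prop))
      (fun t ht => by
        have h1 : HasDerivAt (fun t : ℝ => t ^ 2) (2 * t) t := by
          simpa using hasDerivAt_pow 2 t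
        exact (hyd₂ t (hsub s hs t ht)).fun_sub (h1.const_mul _))
      (fun t ht _ => by
        have h1 := deriv_g_mul_le (up := up) (um := um) hf hconv um (um - t)
        rw [g_um] at h1
        have h2 : 0 ≤ friction α (Real.sqrt (y t)) := by
          rw [friction]; positivity
        have h3 : (2 / δ) * (-g f up um (um - t) - ε * friction α (Real.sqrt (y t))) -
            deriv (g f up um) um / δ * (2 * t) = (2 / δ) * (-g f up um (um - t) -
              ε * friction α (Real.sqrt (y t)) - deriv (g f up um) um * t) := by ring
        rw [h3]
        refine mul_nonpos_of_nonneg_of_nonpos hc2.le ?_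
        nlinarith [mul_nonneg hε.le h2])
      (by simp [hy0])
    linarith

/-- The two linear bounds on `√y`, in `s` and in `u₋ - u₊ - s`, make each equilibrium take infinite
time to reach, so the orbit is global. -/
lemma exists_wave (hf : ContDiff ℝ 2 f) (hconv : ∀ u : ℝ, 0 < deriv (deriv f) u)
    (hu : up < um) (hα : 0 ≤ α) (hε : 0 < ε) (hδ : 0 < δ) (hz₀ : 0 < z₀)
    (hcrit : (2 * α - 1) * z₀ ^ 2 ≤ 1) (hS : S f up um ≤ ε * friction α z₀) (hk : 0 < k)
    (hkδ : -deriv (g f up um) up / k + k * δ < ε * (1 + z₀ ^ 2) ^ (-α)) :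
    ∃ v w : ℝ → ℝ, IsMonotoneTravellingWave f up um α ε δ v w := by
  obtain ⟨y, hy⟩ := exists_profile hf hconv hu hα hε hδ hz₀ hcrit hS hk hkδ
  have hL : 0 < um - up := sub_pos.2 hu
  have hC : 0 < deriv (g f up um) um / δ := div_pos (deriv_g_um_pos hf hconv hu) hδ
  have hyc : ContinuousOn y (Ioo 0 (um - up)) := fun s hs =>
    (hy s hs).2.2.2.continuousAt.continuousWithinAt
  have hyC : ∀ s ∈ Ioo 0 (um - up),
      Real.sqrt (y s) ≤ Real.sqrt (deriv (g f up um) um / δ) * s := fun s hs => by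
    calc Real.sqrt (y s) ≤ Real.sqrt (deriv (g f up um) um / δ * s ^ 2) :=
          Real.sqrt_le_sqrt (hy s hs).2.2.1
      _ = _ := by rw [Real.sqrt_mul hC.le, Real.sqrt_sq hs.1.le]
  obtain ⟨X, hX, hXd, hXm, hXbot, hXtop⟩ := exists_flow_connecting (L := um - up)
    (z := fun s => Real.sqrt (y s)) hL (Real.sqrt_pos.2 hC) hk
    (Real.continuous_sqrt.comp_continuousOn hyc) (fun s hs => Real.sqrt_pos.2 (hy s hs).1) hyC
    (fun s hs => (hy s hs).2.1)
  refine ⟨fun t => um - X t, fun t => -Real.sqrt (y (X t)), ⟨fun t => ?_, fun t => ?_, ?_, ?_, ?_,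
    ?_, fun a b hab => by simpa using hXm hab⟩⟩
  · exact (hXd t).const_sub um
  · obtain ⟨h1, -, -, h2⟩ := hy (X t) (hX t)
    have h3 := ((h2.comp t (hXd t)).sqrt h1.ne').neg
    refine h3.congr_deriv ?_
    have h4 := friction_neg α (Real.sqrt (y (X t)))
    have h5 : 0 < Real.sqrt (y (X t)) := Real.sqrt_pos.2 h1
    have h6 : ε * -Real.sqrt (y (X t)) / (1 + (-Real.sqrt (y (X t))) ^ 2) ^ α =
        -(ε * friction α (Real.sqrt (y (X t)))) := by
      rw [mul_div_assoc, ← friction, h4, mul_neg]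
    rw [h6]
    simp only [Function.comp_apply]
    field_simp
    ring
  · simpa using hXbot.const_sub um
  · have h1 : Tendsto (fun t => Real.sqrt (deriv (g f up um) um / δ) * X t) atBot (𝓝 0) := by
      simpa using hXbot.const_mul (Real.sqrt (deriv (g f up um) um / δ))
    simpa using (squeeze_zero (fun t => Real.sqrt_nonneg _) (fun t => hyC _ (hX t)) h1).neg
  · simpa using hXtop.const_sub um
  · have h1 : Tendsto (fun t => k * (um - up - X t)) atTop (𝓝 0) := by
      simpa using (hXtop.const_sub (um - up)).const_mul k
    simpa using (squeeze_zero (fun t => Real.sqrt_nonneg _) (fun t => (hy _ (hX t)).2.1) h1).neg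

end Existence

/-! ### Arbitrary monotone waves and their approach to `u₊` -/

namespace IsMonotoneTravellingWave

variable {f : ℝ → ℝ} {up um α ε δ z₀ k : ℝ} {v w : ℝ → ℝ}

lemma mem_Ioo (hw : IsMonotoneTravellingWave f up um α ε δ v w) (t : ℝ) : v t ∈ Ioo up um := by
  have h1 := hw.decreasing.antitone.le_of_tendsto hw.v_atTop (t + 1)
  have h2 := hw.decreasing.antitone.ge_of_tendsto hw.v_atBot (t - 1)
  have h3 := hw.decreasing (show t < t + 1 by linarith)
  have h4 := hw.decreasing (show t - 1 < t by linarith)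
  exact ⟨by linarith, by linarith⟩

/-- A zero of `w ≤ 0` would be a maximum, but there `w' = g(v)/δ < 0`. -/
lemma w_neg (hw : IsMonotoneTravellingWave f up um α ε δ v w) (hf : ContDiff ℝ 2 f)
    (hconv : ∀ u : ℝ, 0 < deriv (deriv f) u) (hδ : 0 < δ) (t : ℝ) : w t < 0 := by
  have hle : ∀ t, w t ≤ 0 := fun t => by
    rw [← (hw.v_eq t).deriv]
    exact hw.decreasing.antitone.deriv_nonpos
  refine lt_of_le_of_ne (hle t) fun h0 => ?_
  have hmax : IsLocalMax w t := Eventually.of_forall fun s => by rw [h0]; exact hle s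
  have h1 := hmax.hasDerivAt_eq_zero (hw.w_eq t)
  have h2 := g_neg hf hconv (hw.mem_Ioo t)
  have h3 : (1 / δ) * g f up um (v t) < 0 := mul_neg_of_pos_of_neg (by positivity) h2
  rw [h0] at h1
  simp only [mul_zero, zero_div, neg_zero, zero_add] at h1
  linarith

lemma hasDerivAt_neg_w (hw : IsMonotoneTravellingWave f up um α ε δ v w) (t : ℝ) :
    HasDerivAt (fun t => -w t) ((1 / δ) * (-g f up um (v t) - ε * friction α (-w t))) t := by
  refine (hw.w_eq t).neg.congr_deriv ?_
  rw [friction_neg, friction]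
  ring

lemma neg_w_le (hw : IsMonotoneTravellingWave f up um α ε δ v w) (hf : ContDiff ℝ 2 f)
    (hα : 0 ≤ α) (hε : 0 < ε) (hδ : 0 < δ) (hz₀ : 0 < z₀)
    (hS : S f up um ≤ ε * friction α z₀) (t : ℝ) : -w t ≤ z₀ := by
  have h0 : ∀ᶠ s in atBot, -w s ≤ z₀ := by
    have h := hw.w_atBot.neg
    rw [neg_zero] at h
    exact h.eventually (ge_mem_nhds hz₀)
  obtain ⟨s, hs, hst⟩ := (h0.and (eventually_le_atBot t)).exists
  -- No cap is available here: the weight `exp(-Kt)` absorbs the possible decrease of friction above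
  -- `z₀`, at rate at most `2αε/δ`.
  set K := 2 * α * ε / δ with hK
  have hexp : ∀ t : ℝ, HasDerivAt (fun t => Real.exp (-(K * t))) (-(K * Real.exp (-(K * t)))) t :=
    fun t => (((hasDerivAt_id t).const_mul K).neg.exp).congr_deriv (by simp; ring)
  have hd : ∀ t : ℝ, HasDerivAt (fun t => Real.exp (-(K * t)) * (-w t - z₀))
      (Real.exp (-(K * t)) * ((1 / δ) * (-g f up um (v t) - ε * friction α (-w t)) -
        K * (-w t - z₀))) t := fun t =>
    ((hexp t).fun_mul ((hw.hasDerivAt_neg_w t).sub_const z₀)).congr_deriv (by ring)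
  have key := nonpos_of_deriv_nonpos_of_pos hst
    (fun x _ => (hd x).continuousAt.continuousWithinAt) (fun x _ => hd x)
    (fun x _ hpos => by
      have hx : 0 < -w x - z₀ := pos_of_mul_pos_right hpos (Real.exp_pos _).le
      have h1 := mul_le_mul_of_nonneg_left
        (friction_sub_le hα (show z₀ ≤ -w x by linarith)) hε.le
      have h2 := neg_g_le_S hf (Ioo_subset_Icc_self (hw.mem_Ioo x))
      refine mul_nonpos_of_nonneg_of_nonpos (Real.exp_pos _).le ?_
      have h3 : (1 / δ) * (-g f up um (v x) - ε * friction α (-w x)) - K * (-w x - z₀) =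
          (1 / δ) * (-g f up um (v x) - ε * friction α (-w x) -
            2 * α * ε * (-w x - z₀)) := by rw [hK]; ring
      rw [h3]
      refine mul_nonpos_of_nonneg_of_nonpos (by positivity) ?_
      linarith)
    (mul_nonpos_of_nonneg_of_nonpos (Real.exp_pos _).le (by linarith))
  have := nonpos_of_mul_nonpos_right key (Real.exp_pos _)
  linarith

/-- Near `-∞` the orbit is strictly inside the ray, since `w → 0` while `v → u₋ > u₊`; the barrier
keeps it there. -/
lemma neg_w_le_ray (hw : IsMonotoneTravellingWave f up um α ε δ v w) (hf : ContDiff ℝ 2 f)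
    (hconv : ∀ u : ℝ, 0 < deriv (deriv f) u) (hu : up < um)
    (hα : 0 ≤ α) (hε : 0 < ε) (hδ : 0 < δ) (hz₀ : 0 < z₀)
    (hS : S f up um ≤ ε * friction α z₀) (hk : 0 < k)
    (hkδ : -deriv (g f up um) up / k + k * δ < ε * (1 + z₀ ^ 2) ^ (-α)) (t : ℝ) :
    -w t ≤ k * (v t - up) := by
  have h0 : ∀ᶠ s in atBot, -w s - k * (v s - up) < 0 := by
    have h := hw.w_atBot.neg.sub ((hw.v_atBot.sub_const up).const_mul k)
    refine h.eventually (gt_mem_nhds ?_)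
    have : 0 < k * (um - up) := mul_pos hk (by linarith)
    linarith
  obtain ⟨s, hs, hst⟩ := (h0.and (eventually_le_atBot t)).exists
  have hd : ∀ t : ℝ, HasDerivAt (fun t => -w t - k * (v t - up))
      ((1 / δ) * (-g f up um (v t) - ε * friction α (-w t)) + k * -w t) t := fun t =>
    ((hw.hasDerivAt_neg_w t).fun_sub (((hw.v_eq t).sub_const up).const_mul k)).congr_deriv
      (by ring)
  have key := nonpos_of_deriv_nonpos_of_pos hst
    (fun x _ => (hd x).continuousAt.continuousWithinAt) (fun x _ => hd x)
    (fun x _ hpos => ray_barrier hf hconv hu hα hε hδ hk hkδ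
      (by linarith [hw.w_neg hf hconv hδ x]) (hw.neg_w_le hf hα hε hδ hz₀ hS x) (by linarith))
    hs.le
  linarith

lemma entersThroughMainDirection (hw : IsMonotoneTravellingWave f up um α ε δ v w)
    (hf : ContDiff ℝ 2 f) (hconv : ∀ u : ℝ, 0 < deriv (deriv f) u) (hu : up < um)
    (hα : 0 ≤ α) (hε : 0 < ε) (hδ : 0 < δ) (hz₀ : 0 < z₀)
    (hS : S f up um ≤ ε * friction α z₀) (hk : 0 < k)
    (hkδ : -deriv (g f up um) up / k + k * δ < ε * (1 + z₀ ^ 2) ^ (-α)) :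
    EntersThroughMainDirection f up um ε δ v w := by
  set m := -deriv (g f up um) up with hm
  have hkε : m + k ^ 2 * δ < ε * k := by
    have h1 : (1 + z₀ ^ 2) ^ (-α) ≤ 1 :=
      Real.rpow_le_one_of_one_le_of_nonpos (by nlinarith [sq_nonneg z₀]) (by linarith)
    have h2 : m / k + k * δ < ε := by nlinarith
    calc m + k ^ 2 * δ = (m / k + k * δ) * k := by field_simp
      _ < ε * k := mul_lt_mul_of_pos_right h2 hk
  have hdisc_eq : disc f up um ε δ = (ε / δ) ^ 2 - 4 * (m / δ) := by
    rw [disc, hm]; ring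
  -- The characteristic polynomial is negative at `-k`, so both eigenvalues are real and `χ₋ < -k <
  -- χ₊`.
  have hsq : (2 * k - ε / δ) ^ 2 < disc f up um ε δ := by
    have h1 : (m + k ^ 2 * δ) / δ < ε * k / δ := div_lt_div_of_pos_right hkε hδ
    have h2 : (m + k ^ 2 * δ) / δ = m / δ + k ^ 2 := by field_simp
    have h3 : ε * k / δ = ε / δ * k := by ring
    rw [hdisc_eq]
    nlinarith
  have hdisc : 0 < disc f up um ε δ := (sq_nonneg _).trans_lt hsq
  refine ⟨hdisc, ?_⟩
  set r := Real.sqrt (disc f up um ε δ) with hr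
  have hrsq : r ^ 2 = (ε / δ) ^ 2 - 4 * (m / δ) := by rw [hr, Real.sq_sqrt hdisc.le, hdisc_eq]
  have habs : |2 * k - ε / δ| < r := Real.lt_sqrt_of_sq_lt (by rwa [sq_abs])
  set χ := chiPlus f up um ε δ with hχ
  have hχ' : χ = (1 / 2) * (-(ε / δ) + r) := rfl
  set χ' := (1 / 2) * (-(ε / δ) - r) with hχ''
  set η := -k - χ' with hη
  have hη0 : 0 < η := by
    have := (abs_lt.1 habs).2
    rw [hη, hχ'']
    linarith
  have hvpos : ∀ t, 0 < v t - up := fun t => sub_pos.2 (hw.mem_Ioo t).1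
  set Q : ℝ → ℝ := fun t => w t / (v t - up) with hQ
  have hQk : ∀ t, -k ≤ Q t := fun t => by
    rw [hQ, le_div_iff₀ (hvpos t)]
    linarith [hw.neg_w_le_ray hf hconv hu hα hε hδ hz₀ hS hk hkδ t]
  have hQ0 : ∀ t, Q t < 0 := fun t => div_neg_of_neg_of_pos (hw.w_neg hf hconv hδ t) (hvpos t)
  set A : ℝ → ℝ := fun t => (1 + w t ^ 2) ^ (-α) with hA
  set B : ℝ → ℝ := fun t => g f up um (v t) / (v t - up) with hB
  -- The defect from the linearised Riccati equation. It tends to `0` because `Q` is bounded, by the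
  -- ray and by `w < 0`.
  set e : ℝ → ℝ := fun t => (1 / δ) * (ε * (1 - A t) * Q t + (B t + m)) with he
  have hQd : ∀ t, HasDerivAt Q (-((Q t - χ) * (Q t - χ')) + e t) t := by
    intro t
    have h1 := (hw.w_eq t).fun_div ((hw.v_eq t).sub_const up) (hvpos t).ne'
    refine h1.congr_deriv ?_
    have h2 : -((Q t - χ) * (Q t - χ')) = -Q t ^ 2 - ε / δ * Q t - m / δ := by
      rw [hχ', hχ'']
      linear_combination (1 / 4) * hrsq
    have h3 : ε * w t / (1 + w t ^ 2) ^ α = ε * A t * w t := by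
      simp only [hA]
      rw [Real.rpow_neg (by positivity)]
      ring
    have h4 := (hvpos t).ne'
    rw [h2, h3, he, hQ, hB]
    simp only
    field_simp
    ring
  have hAlim : Tendsto A atTop (𝓝 1) := by
    have h1 := ((hw.w_atTop.pow 2).const_add 1).rpow_const (p := -α) (Or.inl (by norm_num))
    simpa using h1
  have hBlim : Tendsto B atTop (𝓝 (-m)) := by
    have h1 : HasDerivAt (g f up um) (-m) up := by
      rw [hm, neg_neg]
      exact (differentiable_g hf up).hasDerivAt
    have h2 := (hasDerivAt_iff_tendsto_slope.1 h1).comp (tendsto_nhdsWithin_iff.2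
      ⟨hw.v_atTop, Eventually.of_forall fun t => (hw.mem_Ioo t).1.ne'⟩)
    refine h2.congr fun t => ?_
    simp only [Function.comp_apply, slope_def_field, g_up hu, sub_zero, hB]
  have helim : Tendsto e atTop (𝓝 0) := by
    have hbd : ∀ t, |e t| ≤ (1 / δ) * (ε * |1 - A t| * k + |B t + m|) := fun t => by
      have hQa : |Q t| ≤ k := abs_le.2 ⟨hQk t, (hQ0 t).le.trans hk.le⟩
      rw [he]
      simp only
      rw [abs_mul, abs_of_pos (show 0 < 1 / δ by positivity)]
      refine mul_le_mul_of_nonneg_left ?_ (by positivity)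
      refine (abs_add_le _ _).trans (add_le_add ?_ le_rfl)
      rw [abs_mul, abs_mul, abs_of_pos hε]
      exact mul_le_mul_of_nonneg_left hQa (by positivity)
    have hlim : Tendsto (fun t => (1 / δ) * (ε * |1 - A t| * k + |B t + m|)) atTop (𝓝 0) := by
      have h1 : Tendsto (fun t => |1 - A t|) atTop (𝓝 0) := by
        simpa using (hAlim.const_sub 1).abs
      have h2 : Tendsto (fun t => |B t + m|) atTop (𝓝 0) := by
        simpa using (hBlim.add_const m).abs
      simpa using (((h1.const_mul ε).mul_const k).add h2).const_mul (1 / δ)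
    exact squeeze_zero_norm hbd hlim
  rw [Metric.tendsto_nhds]
  intro σ hσ
  have hσ2 : 0 < σ / 2 := half_pos hσ
  obtain ⟨T, hT⟩ := eventually_atTop.1 (helim.abs.eventually
    (ge_mem_nhds (show |(0:ℝ)| < η * (σ / 2) / 2 by rw [abs_zero]; positivity)))
  -- With `d = |Q - χ₊| > σ/2` and `|e| ≤ ησ/4`, the derivative of `d²` is at most `-2ηd² + ησd/2 ≤
  -- -ηd²`, since `Q - χ₋ ≥ η`.
  have hev := eventually_le_of_deriv_le (y := fun t => (Q t - χ) ^ 2)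
    (y' := fun t => 2 * (Q t - χ) * (-((Q t - χ) * (Q t - χ')) + e t)) (T := T)
    (c := (σ / 2) ^ 2) (κ := η * (σ / 2) ^ 2) (by positivity)
    (fun t => (((hQd t).sub_const χ).fun_pow 2).congr_deriv (by ring))
    (fun t ht hlt => by
      have h1 : σ / 2 < |Q t - χ| := by
        have := sq_lt_sq.1 hlt
        rwa [abs_of_pos hσ2] at this
      have h2 : η ≤ Q t - χ' := by rw [hη]; linarith [hQk t]
      have h3 := mul_le_mul_of_nonneg_left h2 (sq_nonneg (Q t - χ))
      have h4 : (Q t - χ) * e t ≤ |Q t - χ| * |e t| := by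
        rw [← abs_mul]; exact le_abs_self _
      have h5 := mul_le_mul_of_nonneg_left (hT t ht) (abs_nonneg (Q t - χ))
      have h6 := mul_le_mul_of_nonneg_left h1.le (abs_nonneg (Q t - χ))
      have h7 := abs_mul_abs_self (Q t - χ)
      have h8 := mul_le_mul_of_nonneg_left h6 hη0.le
      have h9 := mul_lt_mul_of_pos_left hlt hη0
      nlinarith)
  filter_upwards [hev] with t ht
  rw [Real.dist_eq]
  have := abs_le_of_sq_le_sq ht hσ2.le
  linarith

end IsMonotoneTravellingWave

end RosenauKdV

theorem mainTheorem3 (f : ℝ → ℝ) (hf : ContDiff ℝ 2 f) (hconv : ∀ u : ℝ, 0 < deriv (deriv f) u)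
    (up um : ℝ) (hu : up < um) :
    Tendsto (fun a : ℝ => RosenauKdV.epsMin f up um a) (𝓝[>] (1 / 2))
      (𝓝 (RosenauKdV.S f up um)) ∧
    ∀ α : ℝ, 0 ≤ α → ∀ ε : ℝ,
      (RosenauKdV.threshold f up um α < ε ∨ (1 / 2 < α ∧ ε = RosenauKdV.epsMin f up um α)) →
      ∃ δ₀ : ℝ, 0 < δ₀ ∧ ∀ δ : ℝ, 0 < δ → δ < δ₀ →
        (∃ v w : ℝ → ℝ, RosenauKdV.IsMonotoneTravellingWave f up um α ε δ v w) ∧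
        ∀ v w : ℝ → ℝ, RosenauKdV.IsMonotoneTravellingWave f up um α ε δ v w →
          RosenauKdV.EntersThroughMainDirection f up um ε δ v w := by
  refine ⟨RosenauKdV.tendsto_epsMin f up um, fun α hα ε hε' => ?_⟩
  obtain ⟨hε, z₀, hz₀, hcrit, hS⟩ :=
    RosenauKdV.exists_balancing_slope hα (RosenauKdV.S_pos hf hconv hu) hε'
  set m := -deriv (RosenauKdV.g f up um) up with hm
  have hm0 : 0 < m := by linarith [RosenauKdV.deriv_g_up_neg hf hconv hu]
  set c := ε * (1 + z₀ ^ 2) ^ (-α) with hc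
  have hc0 : 0 < c := mul_pos hε (Real.rpow_pos_of_pos (by positivity) _)
  -- With `k = 2m/c`, `m/k` is `c/2` and `δ < c²/(4m)` makes `kδ < c/2`. No `k` allows a larger
  -- range of `δ`, as `m/k + kδ ≥ 2√(mδ)`.
  have hk : 0 < 2 * m / c := by positivity
  refine ⟨c ^ 2 / (4 * m), by positivity, fun δ hδ hδ₀ => ?_⟩
  have hkδ : m / (2 * m / c) + 2 * m / c * δ < c := by
    have h1 : 2 * m / c * δ < 2 * m / c * (c ^ 2 / (4 * m)) := mul_lt_mul_of_pos_left hδ₀ hk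
    have h2 : 2 * m / c * (c ^ 2 / (4 * m)) = c / 2 := by field_simp; ring
    have h3 : m / (2 * m / c) = c / 2 := by field_simp
    linarith
  exact ⟨RosenauKdV.exists_wave hf hconv hu hα hε hδ hz₀ hcrit hS hk hkδ, fun v w hw =>
    hw.entersThroughMainDirection hf hconv hu hα hε hδ hz₀ hS hk hkδ⟩
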